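/- Let $V=\bigoplus_{n\in\mathbb Z}V_n$ be a vertex operator algebra over $\mathbb C$, with vertex operators $Y(v,z)=\sum_{n\in\mathbb Z}v_nz^{-n-1}$, vacuum vector $\mathbf 1$ and conformal vector $\omega$, so that $L(0)=\omega_1$ acts on $V_n$ as multiplication by $n$. Assume that $V$ is of CFT type, that is, $V_n=0$ for $n<0$ and $V_0=\mathbb C\mathbf 1$, and that $V$ is $C_2$-cofinite, that is, $V/C_2(V)$ is finite dimensional, where $C_2(V)$ is the linear span of all $u_{-2}v$ with $u,v\in V$. A weak $V$-module is a complex vector space $M$ with a linear map $v\mapsto Y_M(v,z)=\sum_{n\in\mathbb Z}v_nz^{-n-1}$ from $V$ to $(\operatorname{End}M)[[z,z^{-1}]]$ such that $v_nw=0$ for all sufficiently large $n$ (for each $v\in V$, $w\in M$), $Y_M(\mathbf 1,z)=\mathrm{id}_M$, and the Jacobi identity $$z_0^{-1}\delta\Big(\frac{z_1-z_2}{z_0}\Big)Y_M(u,z_1)Y_M(v,z_2)-z_0^{-1}\delta\Big(\frac{z_2-z_1}{-z_0}\Big)Y_M(v,z_2)Y_M(u,z_1)=z_2^{-1}\delta\Big(\frac{z_1-z_0}{z_2}\Big)Y_M(Y(u,z_0)v,z_2)$$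 holds for all $u,v\in V$. A vector $w\in M$ is a lowest weight vector if $v_nw=0$ for every $k\in\mathbb Z$, every $v\in V_k$ and every $n\in\mathbb Z$ such that the weight $\operatorname{wt}(v_n)=k-n-1$ is negative. Then every nonzero weak $V$-module $M$ contains a nonzero lowest weight vector. -/

import Mathlib

/-- The coefficients of the Jacobi identity, for the vertex operators
`Y(u, z) = ∑ u_n z^(-n-1)` on `V` (given by `Y u n = u_n`) and
`Y_M(u, z) = ∑ u_n z^(-n-1)` on `M` (given by `YM u n = u_n`).
Comparing the coefficients of `z₀^(-l-1) z₁^(-m-1) z₂^(-n-1)` in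
`z₀⁻¹ δ((z₁-z₂)/z₀) Y_M(u,z₁) Y_M(v,z₂) - z₀⁻¹ δ((z₂-z₁)/(-z₀)) Y_M(v,z₂) Y_M(u,z₁)
  = z₂⁻¹ δ((z₁-z₀)/z₂) Y_M(Y(u,z₀)v,z₂)`,
where binomials are expanded in nonnegative powers of their second variable, gives, on `w`,
`∑ᵢ (-1)^i (l choose i) u_{l+m-i} v_{n+i} w - ∑ᵢ (-1)^(l+i) (l choose i) v_{l+n-i} u_{m+i} w
  = ∑ᵢ (m choose i) (u_{l+i} v)_{m+n-i} w`.
All the sums have only finitely many nonzero terms as soon as `Y` and `YM` are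
lower truncated, which is required wherever this is used. -/
def JacobiIdentity {V M : Type*} [AddCommGroup V] [Module ℂ V] [AddCommGroup M] [Module ℂ M]
    (Y : V →ₗ[ℂ] ℤ → Module.End ℂ V) (YM : V →ₗ[ℂ] ℤ → Module.End ℂ M) : Prop :=
  ∀ (u v : V) (w : M) (l m n : ℤ),
    (∑ᶠ i : ℕ, ((-1 : ℤ) ^ i * Ring.choose l i) • YM u (l + m - i) (YM v (n + i) w))
      - (∑ᶠ i : ℕ, ((l.negOnePow : ℤ) * (-1 : ℤ) ^ i * Ring.choose l i) •
          YM v (l + n - i) (YM u (m + i) w))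
      = ∑ᶠ i : ℕ, (Ring.choose m i) • YM (Y u (l + i) v) (m + n - i) w

/-- A vertex operator algebra structure on the complex vector space `V`. -/
structure VertexOperatorAlgebra (V : Type*) [AddCommGroup V] [Module ℂ V] where
  /-- The state-field correspondence: `Y v n` is the mode `v_n` in
  `Y(v, z) = ∑ v_n z^(-n-1)`. -/
  Y : V →ₗ[ℂ] ℤ → Module.End ℂ V
  /-- The vacuum vector `𝟏`. -/
  vac : V
  /-- The conformal (Virasoro) vector. -/
  omega : V
  /-- The central charge. -/
  c : ℂ
  /-- The homogeneous subspaces `V_n`. -/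
  gr : ℤ → Submodule ℂ V
  /-- `u_n v = 0` for `n` large. -/
  truncation : ∀ u v : V, ∃ N : ℤ, ∀ n : ℤ, N ≤ n → Y u n v = 0
  /-- `Y(𝟏, z) = id`. -/
  vacuum : ∀ n : ℤ, Y vac n = if n = -1 then LinearMap.id else 0
  /-- `Y(v, z)𝟏` has no singular terms. -/
  creation : ∀ (v : V) (n : ℤ), 0 ≤ n → Y v n vac = 0
  /-- The constant term of `Y(v, z)𝟏` is `v`. -/
  creation_const : ∀ v : V, Y v (-1) vac = v
  jacobi : JacobiIdentity Y Y
  /-- The operators `L(n) = ω_{n+1}` satisfy the Virasoro relations. -/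
  virasoro : ∀ m n : ℤ,
    Y omega (m + 1) ∘ₗ Y omega (n + 1) - Y omega (n + 1) ∘ₗ Y omega (m + 1) =
      ((m : ℂ) - (n : ℂ)) • Y omega (m + n + 1) +
        (if m + n = 0 then (((m : ℂ) ^ 3 - (m : ℂ)) / 12 * c) • LinearMap.id else 0)
  /-- `Y(L(-1)v, z) = d/dz Y(v, z)`. -/
  derivation : ∀ (v : V) (n : ℤ), Y (Y omega 0 v) n = (-(n : ℂ)) • Y v (n - 1)
  /-- `V` is the direct sum of the `V_n`. -/
  isInternal : DirectSum.IsInternal gr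
  /-- `L(0)` acts on `V_n` as multiplication by `n`. -/
  weight : ∀ (n : ℤ) (v : V), v ∈ gr n → Y omega 1 v = (n : ℂ) • v
  finite_gr : ∀ n : ℤ, FiniteDimensional ℂ (gr n)
  /-- `V_n = 0` for `n` sufficiently negative. -/
  gr_bounded : ∃ N : ℤ, ∀ n : ℤ, n < N → gr n = ⊥

namespace VertexOperatorAlgebra

variable {V : Type*} [AddCommGroup V] [Module ℂ V]

/-- `V` is of CFT type: `V = ⨁_{n ≥ 0} V_n` and `V_0 = ℂ𝟏`. -/
def IsCFTType (A : VertexOperatorAlgebra V) : Prop :=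
  (∀ n : ℤ, n < 0 → A.gr n = ⊥) ∧ A.gr 0 = Submodule.span ℂ {A.vac}

/-- `C_n(V)`, the linear span of all `u_{-n} v` with `u, v ∈ V`. -/
def C (A : VertexOperatorAlgebra V) (n : ℕ) : Submodule ℂ V :=
  Submodule.span ℂ {x | ∃ u v : V, x = A.Y u (-(n : ℤ)) v}

/-- `C_n`-cofiniteness (for `n ≥ 2`): `V / C_n(V)` is finite dimensional. -/
def IsCofinite (A : VertexOperatorAlgebra V) (n : ℕ) : Prop :=
  FiniteDimensional ℂ (V ⧸ A.C n)

/-- A weak module structure on the complex vector space `M` for the vertex operator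
algebra `A` on `V`. -/
structure WeakModule (A : VertexOperatorAlgebra V)
    (M : Type*) [AddCommGroup M] [Module ℂ M] where
  /-- `Y v n` is the mode `v_n` in `Y_M(v, z) = ∑ v_n z^(-n-1)`. -/
  Y : V →ₗ[ℂ] ℤ → Module.End ℂ M
  /-- `v_n w = 0` for `n` large. -/
  truncation : ∀ (v : V) (w : M), ∃ N : ℤ, ∀ n : ℤ, N ≤ n → Y v n w = 0
  /-- `Y_M(𝟏, z) = id`. -/
  vacuum : ∀ n : ℤ, Y A.vac n = if n = -1 then LinearMap.id else 0
  jacobi : JacobiIdentity A.Y Y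

/-- `w` is a lowest weight vector: `v_n w = 0` for each homogeneous `v`, say `v ∈ V_k`, and each
`n` such that the weight `wt(v_n) = k - n - 1` of the operator `v_n` is negative. -/
def WeakModule.IsLowestWeightVector {A : VertexOperatorAlgebra V}
    {M : Type*} [AddCommGroup M] [Module ℂ M] (W : A.WeakModule M) (w : M) : Prop :=
  ∀ (k : ℤ) (v : V), v ∈ A.gr k → ∀ n : ℤ, k - n - 1 < 0 → W.Y v n w = 0

end VertexOperatorAlgebra

/-!
For a nonzero `w`, plot the weights of the modes `v_n`, `v ∈ V_k`, with `v_n w ≠ 0` against `k`, and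
bound them from below by a line of slope `-r` through the origin. Outside a finite set of
degrees, `V_k` is spanned by the products `u_{-2} v` of homogeneous elements, and the iterate
formula writes `(u_{-2} v)_n w` through products of modes of `u` and `v` of the same total weight,
but of total degree `k - 1`; if `(u_{-2} v)_n` lies on or below the line, then one factor lies below
it. Hence the bound only has to be checked in finitely many degrees, so that it holds for some `r`,
and for `r > 0` the modes on the line annihilate `w` outside these degrees.

Modes on the line satisfy `u_m v_n w = (u_{-1} v)_{m+n+1} w`, again a mode on the line. So if
`v_n w ≠ 0` with `v_n` on the line and `v` of the largest possible degree, then no mode of positive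
degree on the line acts nontrivially on `v_n w`, which therefore has smaller slope. The slopes have
a common denominator, so finitely many such steps lead to slope `0`, a lowest weight vector.
-/

theorem inf_iSup_eq_of_iSupIndep {ι α : Type*} [CompleteLattice α] [IsModularLattice α]
    {f g : ι → α} (hg : iSupIndep g) (hfg : f ≤ g) (i : ι) : g i ⊓ ⨆ j, f j = f i := by
  have hdisj : g i ⊓ ⨆ (j) (_ : j ≠ i), f j = ⊥ :=
    ((hg i).mono_right (iSup₂_mono fun j _ => hfg j)).eq_bot
  rw [iSup_split_single f i, inf_comm, sup_inf_assoc_of_le _ (hfg i), inf_comm, hdisj, sup_bot_eq]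

theorem neg_one_pow_mul_ringChoose_neg_one (i : ℕ) : (-1 : ℤ) ^ i * Ring.choose (-1 : ℤ) i = 1 := by
  rw [Ring.choose_neg, add_sub_cancel_left, Ring.choose_natCast]
  simp [Units.smul_def, Int.coe_negOnePow_natCast, ← mul_pow]

theorem finsum_ringChoose_natCast_smul {G : Type*} [AddCommGroup G] (m : ℕ) (f : ℕ → G) :
    ∑ᶠ i, Ring.choose (m : ℤ) i • f i = ∑ i ∈ Finset.range (m + 1), m.choose i • f i := by
  simp only [Ring.choose_natCast, natCast_zsmul]
  refine finsum_eq_sum_of_support_subset _ fun i hi => ?_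
  by_contra hmi
  rw [Finset.mem_coe, Finset.mem_range, not_lt, Nat.succ_le_iff] at hmi
  exact hi (by simp [Nat.choose_eq_zero_of_lt hmi])

theorem div_mul_lt_intCast_iff {D k : ℤ} (hD : 0 < D) (hk : 0 < k) (hkD : k ∣ D) (q t : ℤ) :
    (q : ℚ) / D * k < t ↔ (q + 1 : ℚ) / D * k ≤ t := by
  obtain ⟨L, rfl⟩ := hkD
  have hL : 0 < L := pos_of_mul_pos_right hD hk.le
  have hk' : (k : ℚ) ≠ 0 := by exact_mod_cast hk.ne'
  have hL' : (0 : ℚ) < L := by exact_mod_cast hL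
  have hcancel (a : ℚ) : a / ((k * L : ℤ) : ℚ) * k = a / L := by
    push_cast
    field_simp
  rw [hcancel, hcancel, div_lt_iff₀ hL', div_le_iff₀ hL']
  exact_mod_cast Int.lt_iff_add_one_le

namespace JacobiIdentity

variable {V M : Type*} [AddCommGroup V] [Module ℂ V] [AddCommGroup M] [Module ℂ M]
  {Y : V →ₗ[ℂ] ℤ → Module.End ℂ V} {YM : V →ₗ[ℂ] ℤ → Module.End ℂ M}

theorem commutator (h : JacobiIdentity Y YM) (u v : V) (w : M) (m n : ℤ) :
    YM u m (YM v n w) - YM v n (YM u m w) =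
      ∑ᶠ i : ℕ, Ring.choose m i • YM (Y u i v) (m + n - i) w := by
  have hjacobi := h u v w 0 m n
  rw [finsum_eq_single _ 0 fun i hi => by simp [Ring.choose_zero_ite, hi],
    finsum_eq_single _ 0 fun i hi => by simp [Ring.choose_zero_ite, hi]] at hjacobi
  simpa using hjacobi

theorem iterate (h : JacobiIdentity Y YM) (u v : V) (w : M) (l n : ℤ) :
    YM (Y u l v) n w =
      (∑ᶠ i : ℕ, ((-1 : ℤ) ^ i * Ring.choose l i) • YM u (l - i) (YM v (n + i) w)) -
      ∑ᶠ i : ℕ, ((l.negOnePow : ℤ) * (-1 : ℤ) ^ i * Ring.choose l i) •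
          YM v (l + n - i) (YM u i w) := by
  have hjacobi := h u v w l 0 n
  rw [← Nat.cast_zero, finsum_ringChoose_natCast_smul] at hjacobi
  simpa using hjacobi.symm

end JacobiIdentity

namespace VertexOperatorAlgebra

variable {V : Type*} [AddCommGroup V] [Module ℂ V] (A : VertexOperatorAlgebra V)

theorem gr_eq_eigenspace (n : ℤ) :
    A.gr n = Module.End.eigenspace (A.Y A.omega 1) (n : ℂ) := by
  have hindep := (Module.End.eigenspaces_iSupIndep (A.Y A.omega 1)).comp
    (Int.cast_injective (α := ℂ))
  have hle : A.gr ≤ Module.End.eigenspace (A.Y A.omega 1) ∘ Int.cast := fun n v hv =>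
    Module.End.mem_eigenspace_iff.2 (A.weight n v hv)
  simpa [A.isInternal.submodule_iSup_eq_top] using (inf_iSup_eq_of_iSupIndep hindep hle n).symm

theorem omega_one_mode_apply {j : ℤ} {u : V} (hu : u ∈ A.gr j) (n : ℤ) (v : V) :
    A.Y A.omega 1 (A.Y u n v) =
      ((j : ℂ) - n - 1) • A.Y u n v + A.Y u n (A.Y A.omega 1 v) := by
  have hcomm := A.jacobi.commutator A.omega u v (1 : ℕ) n
  rw [finsum_ringChoose_natCast_smul] at hcomm
  simp only [Finset.sum_range_succ, Finset.range_zero, Finset.sum_empty, Nat.cast_zero,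
    Nat.cast_one, Nat.choose_zero_right, Nat.choose_self, one_smul, zero_add, sub_zero,
    A.derivation, A.weight j u hu, map_smul, Pi.smul_apply, LinearMap.smul_apply,
    add_sub_cancel_left] at hcomm
  rw [sub_eq_iff_eq_add.1 hcomm, ← add_smul]
  congr 2
  push_cast
  ring

theorem mode_mem_gr {j k : ℤ} {u v : V} (hu : u ∈ A.gr j) (hv : v ∈ A.gr k) (n : ℤ) :
    A.Y u n v ∈ A.gr (j + k - n - 1) := by
  rw [gr_eq_eigenspace, Module.End.mem_eigenspace_iff, A.omega_one_mode_apply hu,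
    A.weight k v hv, map_smul, ← add_smul]
  congr 1
  push_cast
  ring

/-- The weight `k` part of `C_n(V)`, given by its homogeneous generators `u_{-n} v`. -/
def CPart (n : ℕ) (k : ℤ) : Submodule ℂ V :=
  Submodule.span ℂ
    {x | ∃ i j : ℤ, ∃ u ∈ A.gr i, ∃ v ∈ A.gr j, i + j + n - 1 = k ∧ x = A.Y u (-(n : ℤ)) v}

theorem CPart_le_gr (n : ℕ) : A.CPart n ≤ A.gr := by
  refine fun k => Submodule.span_le.2 ?_
  rintro _ ⟨i, j, u, hu, v, hv, rfl, rfl⟩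
  simpa using A.mode_mem_gr hu hv (-(n : ℤ))

theorem C_le_iSup_CPart (n : ℕ) : A.C n ≤ ⨆ k, A.CPart n k := by
  refine Submodule.span_le.2 ?_
  rintro _ ⟨u, v, rfl⟩
  have hmem (v : V) : v ∈ ⨆ k, A.gr k := A.isInternal.submodule_iSup_eq_top ▸ Submodule.mem_top
  induction hmem u using Submodule.iSup_induction' with
  | zero => simp
  | add u u' _ _ hu hu' => simpa using add_mem hu hu'
  | mem i u hu =>
    induction hmem v using Submodule.iSup_induction' with
    | zero => simp
    | add v v' _ _ hv hv' => simpa using add_mem hv hv'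
    | mem j v hv =>
      exact Submodule.mem_iSup_of_mem (i + j + n - 1)
        (Submodule.subset_span ⟨i, j, u, hu, v, hv, rfl, rfl⟩)

variable {A}

theorem IsCofinite.exists_biSup_gr_sup_C_eq_top {n : ℕ} (h : A.IsCofinite n) :
    ∃ s : Finset ℤ, (⨆ k ∈ s, A.gr k) ⊔ A.C n = ⊤ := by
  have htop : ⨆ k, (A.gr k).map (A.C n).mkQ = ⊤ := by
    rw [← Submodule.map_iSup, A.isInternal.submodule_iSup_eq_top, Submodule.map_top,
      Submodule.range_mkQ]
  have hcompact : IsCompactElement (⊤ : Submodule ℂ (V ⧸ A.C n)) :=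
    (Submodule.fg_iff_compact _).1 (h : Module.Finite ℂ (V ⧸ A.C n)).fg_top
  obtain ⟨s, hs⟩ :=
    CompleteLattice.IsCompactElement.exists_finset_of_le_iSup _ hcompact _ htop.ge
  refine ⟨s, ?_⟩
  rw [sup_comm, ← Submodule.comap_map_mkQ]
  simp only [Submodule.map_iSup, top_le_iff.1 hs, Submodule.comap_top]

theorem IsCofinite.exists_gr_le_CPart {n : ℕ} (h : A.IsCofinite n) :
    ∃ s : Finset ℤ, ∀ k ∉ s, A.gr k ≤ A.CPart n k := by
  obtain ⟨s, hs⟩ := h.exists_biSup_gr_sup_C_eq_top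
  let f : ℤ → Submodule ℂ V := fun k => if k ∈ s then A.gr k else A.CPart n k
  have hf_le : f ≤ A.gr := fun k => by
    by_cases hk : k ∈ s
    · simp [f, hk]
    · simpa [f, hk] using A.CPart_le_gr n k
  have le_hf (k : ℤ) : A.CPart n k ≤ f k := by
    by_cases hk : k ∈ s
    · simpa [f, hk] using A.CPart_le_gr n k
    · simp [f, hk]
  have hf_top : ⨆ k, f k = ⊤ := by
    refine top_le_iff.1 (hs.ge.trans (sup_le (iSup₂_le fun k hk => ?_)
      ((A.C_le_iSup_CPart n).trans (iSup_mono le_hf))))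
    exact le_iSup_of_le k (by simp [f, hk])
  refine ⟨s, fun k hk => ?_⟩
  have hfk := inf_iSup_eq_of_iSupIndep A.isInternal.submodule_iSupIndep hf_le k
  simp only [hf_top, inf_top_eq, f, if_neg hk] at hfk
  exact hfk.le

namespace WeakModule

variable {M : Type*} [AddCommGroup M] [Module ℂ M] (W : A.WeakModule M)

/-- The space of all `v ∈ V` whose `n`-th mode annihilates `w`. -/
def modeKer (n : ℤ) (w : M) : Submodule ℂ V :=
  LinearMap.ker (LinearMap.applyₗ w ∘ₗ LinearMap.proj n ∘ₗ W.Y)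

variable {W}

@[simp]
theorem mem_modeKer {n : ℤ} {w : M} {v : V} : v ∈ W.modeKer n w ↔ W.Y v n w = 0 :=
  Iff.rfl

theorem exists_forall_le_modeKer {U : Submodule ℂ V} (hU : U.FG) (w : M) :
    ∃ N : ℕ, ∀ n : ℤ, N ≤ n → U ≤ W.modeKer n w := by
  induction U, hU using Submodule.fg_induction with
  | singleton v =>
    obtain ⟨N, hN⟩ := W.truncation v w
    exact ⟨N.toNat, fun n hn => by simpa using hN n (by omega)⟩
  | sup U₁ U₂ _ _ ih₁ ih₂ =>
    obtain ⟨N₁, h₁⟩ := ih₁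
    obtain ⟨N₂, h₂⟩ := ih₂
    exact ⟨max N₁ N₂, fun n hn => sup_le (h₁ n (by omega)) (h₂ n (by omega))⟩

variable (W) in
/-- The slope bound in degree `k`: the modes `v_n` with `v ∈ V_k` whose weight `k - n - 1` is
smaller than `-r k` annihilate `w`. -/
def HasSlopeLEAt (r : ℚ) (k : ℤ) (w : M) : Prop :=
  ∀ n : ℤ, r * k < n - k + 1 → A.gr k ≤ W.modeKer n w

variable (W) in
/-- The vector `w` has slope at most `r`: the slope bound `HasSlopeLEAt` holds in all degrees. -/
def HasSlopeLE (r : ℚ) (w : M) : Prop :=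
  ∀ k : ℤ, W.HasSlopeLEAt r k w

variable (W) in
/-- The vector `w` has slope less than `r`: the modes of weight at most `-r k` of elements of `V_k`
annihilate `w`. Degree `0` is excluded because `𝟏_{-1}`, of weight `0`, is the identity. -/
def HasSlopeLT (r : ℚ) (w : M) : Prop :=
  ∀ k n : ℤ, 0 < k → r * k ≤ n - k + 1 → A.gr k ≤ W.modeKer n w

variable {r : ℚ} {w : M}

theorem hasSlopeLE_zero_iff : W.HasSlopeLE 0 w ↔ W.IsLowestWeightVector w := by
  have hiff (k n : ℤ) : (0 : ℚ) * k < n - k + 1 ↔ k - n - 1 < 0 := by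
    rw [zero_mul]
    norm_cast
    omega
  simp only [HasSlopeLE, HasSlopeLEAt, IsLowestWeightVector, hiff, SetLike.le_def, mem_modeKer]
  exact forall_congr' fun k => ⟨fun h v hv n hn => h n hn hv, fun h n hn v hv => h v hv n hn⟩

theorem hasSlopeLEAt_of_nonpos (hCFT : A.IsCFTType) {k : ℤ} (hk : k ≤ 0) :
    W.HasSlopeLEAt r k w := by
  intro n hn
  rcases hk.lt_or_eq with hk | rfl
  · exact (hCFT.1 k hk).trans_le bot_le
  · have hn' : n ≠ -1 := by
      rintro rfl
      norm_num at hn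
    simp [hCFT.2, W.vacuum, hn']

section Products

variable {j k : ℤ} {u v : V}

theorem mode_apply_comm (hr : 0 ≤ r) (h : ∀ i < j + k, W.HasSlopeLEAt r i w)
    (hu : u ∈ A.gr j) (hv : v ∈ A.gr k) {m n : ℤ}
    (hmn : r * (j + k - 1) < m + n - j - k + 2) :
    W.Y u m (W.Y v n w) = W.Y v n (W.Y u m w) := by
  rw [← sub_eq_zero, W.jacobi.commutator]
  refine finsum_eq_zero_of_forall_eq_zero fun i => ?_
  have hslope : r * ((j + k - i - 1 : ℤ) : ℚ) <
      ((m + n - i : ℤ) : ℚ) - ((j + k - i - 1 : ℤ) : ℚ) + 1 := by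
    have hi : 0 ≤ r * i := by positivity
    push_cast
    linarith
  rw [mem_modeKer.1 (h _ (by omega) _ hslope (A.mode_mem_gr hu hv i)), smul_zero]

theorem mode_apply_apply_eq_zero (hr : 0 ≤ r) (h : ∀ i < j + k, W.HasSlopeLEAt r i w)
    (hj : W.HasSlopeLEAt r j w) (hk : W.HasSlopeLEAt r k w)
    (hu : u ∈ A.gr j) (hv : v ∈ A.gr k) {m n : ℤ}
    (hmn : r * (j + k - 1) < m + n - j - k + 2)
    (hor : r * j < m - j + 1 ∨ r * k < n - k + 1) :
    W.Y u m (W.Y v n w) = 0 := by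
  rcases hor with hm | hn
  · rw [mode_apply_comm hr h hu hv hmn, mem_modeKer.1 (hj m hm hu), map_zero]
  · rw [mem_modeKer.1 (hk n hn hv), map_zero]

theorem mode_apply_apply_eq_zero_of_lt (hr : 0 ≤ r) (h : ∀ i < j + k, W.HasSlopeLEAt r i w)
    (hj : W.HasSlopeLEAt r j w) (hk : W.HasSlopeLEAt r k w)
    (hu : u ∈ A.gr j) (hv : v ∈ A.gr k) {m n : ℤ}
    (hmn : r * (j + k) < m + n - j - k + 2) :
    W.Y u m (W.Y v n w) = 0 :=
  mode_apply_apply_eq_zero hr h hj hk hu hv (by linarith)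
    (lt_or_lt_of_add_lt_add (by linarith))

theorem iterate_apply_eq_zero (hr : 0 ≤ r) (h : ∀ i < j + k, W.HasSlopeLEAt r i w)
    (hj : W.HasSlopeLEAt r j w) (hk : W.HasSlopeLEAt r k w)
    (hu : u ∈ A.gr j) (hv : v ∈ A.gr k) {l n : ℤ}
    (hln : r * (j + k) < l + n - j - k + 2) :
    W.Y (A.Y u l v) n w = 0 := by
  have hvu (i : ℕ) : W.Y v (l + n - i) (W.Y u i w) = 0 :=
    mode_apply_apply_eq_zero_of_lt hr (by rwa [add_comm]) hk hj hv hu (by push_cast; linarith)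
  have huv (i : ℕ) : W.Y u (l - i) (W.Y v (n + i) w) = 0 :=
    mode_apply_apply_eq_zero_of_lt hr h hj hk hu hv (by push_cast; linarith)
  simp only [W.jacobi.iterate, huv, hvu, smul_zero, finsum_zero, sub_zero]

theorem iterate_neg_one_apply (hr : 0 < r) (h : ∀ i < j + k, W.HasSlopeLEAt r i w)
    (hj : W.HasSlopeLEAt r j w) (hk : W.HasSlopeLEAt r k w)
    (hu : u ∈ A.gr j) (hv : v ∈ A.gr k) (hj0 : 0 < j) {m n : ℤ}
    (hm : r * j = m - j + 1) (hn : r * k = n - k + 1) :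
    W.Y (A.Y u (-1) v) (m + n + 1) w = W.Y u m (W.Y v n w) := by
  have hj0' : (0 : ℚ) < j := by exact_mod_cast hj0
  have hm0 : 0 ≤ m := by
    have hjm : (j : ℚ) - 1 < m := by linarith [mul_pos hr hj0']
    have : j - 1 < m := by exact_mod_cast hjm
    omega
  lift m to ℕ using hm0
  rw [Int.cast_natCast] at hm
  have huv (i : ℕ) : W.Y u (-1 - i) (W.Y v (m + n + 1 + i) w) = 0 :=
    mode_apply_apply_eq_zero hr.le h hj hk hu hv (by push_cast; linarith)
      (.inr (by push_cast; linarith))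
  have hvu (i : ℕ) (hi : i ≠ m) : W.Y v (-1 + (m + n + 1) - i) (W.Y u i w) = 0 := by
    refine mode_apply_apply_eq_zero hr.le (by rwa [add_comm]) hk hj hv hu
      (by push_cast; linarith) ?_
    rcases lt_or_gt_of_ne hi with hi | hi
    · have hi' : (i : ℚ) < m := by exact_mod_cast hi
      exact .inl (by push_cast; linarith)
    · have hi' : (m : ℚ) < i := by exact_mod_cast hi
      exact .inr (by push_cast; linarith)
  have hcomm : W.Y u m (W.Y v n w) = W.Y v n (W.Y u m w) :=
    mode_apply_comm hr.le h hu hv (by push_cast; linarith)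
  rw [W.jacobi.iterate, finsum_eq_zero_of_forall_eq_zero fun i => by rw [huv, smul_zero],
    finsum_eq_single _ m fun i hi => by rw [hvu i hi, smul_zero], mul_assoc,
    neg_one_pow_mul_ringChoose_neg_one, hcomm, show -1 + ((m : ℤ) + n + 1) - m = n by ring]
  simp

end Products

theorem CPart_two_le_modeKer (hneg : ∀ n < 0, A.gr n = ⊥) (hr : 0 ≤ r) {k n : ℤ}
    (h : ∀ i < k, W.HasSlopeLEAt r i w) (hn : r * (k - 1) < n - k + 1) :
    A.CPart 2 k ≤ W.modeKer n w := by
  refine Submodule.span_le.2 ?_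
  rintro _ ⟨i, j, u, hu, v, hv, rfl, rfl⟩
  rcases lt_or_ge i 0 with hi | hi
  · simp [(Submodule.eq_bot_iff _).1 (hneg i hi) u hu]
  rcases lt_or_ge j 0 with hj | hj
  · simp [(Submodule.eq_bot_iff _).1 (hneg j hj) v hv]
  refine iterate_apply_eq_zero hr (fun d hd => h d (by omega)) (h i (by omega))
    (h j (by omega)) hu hv ?_
  push_cast at hn ⊢
  linarith

theorem hasSlopeLE_of_forall_mem (hCFT : A.IsCFTType) {s : Finset ℤ}
    (hs : ∀ k ∉ s, A.gr k ≤ A.CPart 2 k) (hr : 0 ≤ r)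
    (h : ∀ k ∈ s, 0 < k → W.HasSlopeLEAt r k w) : W.HasSlopeLE r w := by
  intro k
  induction k using Int.strongRec (m := 1) with
  | lt k hk => exact hasSlopeLEAt_of_nonpos hCFT (by omega)
  | ge k hk ih =>
    by_cases hks : k ∈ s
    · exact h k hks (by omega)
    · exact fun n hn => (hs k hks).trans (CPart_two_le_modeKer hCFT.1 hr ih (by linarith))

theorem exists_hasSlopeLE_natCast (hCFT : A.IsCFTType) {s : Finset ℤ}
    (hs : ∀ k ∉ s, A.gr k ≤ A.CPart 2 k) (w : M) : ∃ q : ℕ, W.HasSlopeLE q w := by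
  have hfg : (⨆ k ∈ s, A.gr k).FG :=
    Submodule.fg_biSup s A.gr fun k _ => (Submodule.fg_iff_finiteDimensional _).2 (A.finite_gr k)
  obtain ⟨q, hq⟩ := exists_forall_le_modeKer (W := W) hfg w
  refine ⟨q, hasSlopeLE_of_forall_mem hCFT hs (by positivity) fun k hks hk n hn => ?_⟩
  refine (le_biSup A.gr hks).trans (hq n ?_)
  have hqk : (q : ℤ) ≤ q * k := le_mul_of_one_le_right (by positivity) hk
  have hn' : q * k < n - k + 1 := by exact_mod_cast hn
  omega

theorem HasSlopeLE.mode_apply (h : W.HasSlopeLE r w) (hr : 0 < r) {k : ℤ} {v : V}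
    (hv : v ∈ A.gr k) {n : ℤ} (hn : r * k = n - k + 1) : W.HasSlopeLE r (W.Y v n w) :=
  fun j _ hm _ hu => mode_apply_apply_eq_zero hr.le (fun i _ => h i) (h j) (h k) hu hv
    (by linarith) (.inl hm)

theorem HasSlopeLE.exists_hasSlopeLT (hCFT : A.IsCFTType) {s : Finset ℤ}
    (hs : ∀ k ∉ s, A.gr k ≤ A.CPart 2 k) (hr : 0 < r) (hw : w ≠ 0) (h : W.HasSlopeLE r w) :
    ∃ w' ≠ 0, W.HasSlopeLT r w' := by
  let T : Set ℤ := {k | ∃ n : ℤ, r * k = n - k + 1 ∧ ¬ A.gr k ≤ W.modeKer n w}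
  have hTs : T ⊆ s := fun k ⟨n, hn, hne⟩ => by
    by_contra hks
    exact hne ((hs k hks).trans
      (CPart_two_le_modeKer hCFT.1 hr.le (fun i _ => h i) (by linarith)))
  have hT0 : 0 ∈ T := by
    refine ⟨-1, by simp, fun hle => hw ?_⟩
    have hvac : A.vac ∈ A.gr 0 := hCFT.2 ▸ Submodule.mem_span_singleton_self A.vac
    simpa only [mem_modeKer, W.vacuum, if_true, LinearMap.id_apply] using hle hvac
  obtain ⟨k₀, ⟨n₀, hn₀, hne⟩, hmax⟩ := (s.finite_toSet.subset hTs).exists_maximal ⟨0, hT0⟩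
  obtain ⟨v, hv, hvw⟩ := SetLike.not_le_iff_exists.1 hne
  refine ⟨W.Y v n₀ w, hvw, fun k n hk hn u hu => ?_⟩
  rcases hn.lt_or_eq with hn | hn
  · exact h.mode_apply hr hv hn₀ k n hn hu
  by_contra hne'
  rw [mem_modeKer, ← iterate_neg_one_apply hr (fun i _ => h i) (h k) (h k₀) hu hv hk hn hn₀]
    at hne'
  have hmem : A.Y u (-1) v ∈ A.gr (k + k₀) := by simpa using A.mode_mem_gr hu hv (-1)
  have hT : k + k₀ ∈ T := ⟨n + n₀ + 1, by push_cast; linarith, fun hle => hne' (hle hmem)⟩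
  have hle : k + k₀ ≤ k₀ := hmax hT (by omega)
  omega

theorem HasSlopeLT.hasSlopeLE_div (hCFT : A.IsCFTType) {s : Finset ℤ}
    (hs : ∀ k ∉ s, A.gr k ≤ A.CPart 2 k) {D : ℤ} (hD : 0 < D) (hsD : ∀ k ∈ s, 0 < k → k ∣ D)
    {q : ℕ} (h : W.HasSlopeLT ((q + 1) / D) w) : W.HasSlopeLE (q / D) w := by
  refine hasSlopeLE_of_forall_mem hCFT hs (by positivity) fun k hks hk n hn => h k n hk ?_
  have hiff := div_mul_lt_intCast_iff hD hk (hsD k hks hk) q (n - k + 1)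
  push_cast at hiff
  exact hiff.1 hn

theorem HasSlopeLE.exists_hasSlopeLE_zero_of_div (hCFT : A.IsCFTType) {s : Finset ℤ}
    (hs : ∀ k ∉ s, A.gr k ≤ A.CPart 2 k) {D : ℤ} (hD : 0 < D) (hsD : ∀ k ∈ s, 0 < k → k ∣ D)
    {q : ℕ} (hw : w ≠ 0) (h : W.HasSlopeLE (q / D) w) : ∃ w' ≠ 0, W.HasSlopeLE 0 w' := by
  induction q generalizing w with
  | zero => exact ⟨w, hw, by simpa using h⟩
  | succ q ih =>
    have hD' : (0 : ℚ) < D := by exact_mod_cast hD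
    rw [Nat.cast_succ] at h
    obtain ⟨w', hw', h'⟩ := h.exists_hasSlopeLT hCFT hs (by positivity) hw
    exact ih hw' (h'.hasSlopeLE_div hCFT hs hD hsD)

theorem HasSlopeLE.exists_hasSlopeLE_zero (hCFT : A.IsCFTType) {s : Finset ℤ}
    (hs : ∀ k ∉ s, A.gr k ≤ A.CPart 2 k) {q : ℕ} (hw : w ≠ 0) (h : W.HasSlopeLE q w) :
    ∃ w' ≠ 0, W.HasSlopeLE 0 w' := by
  let D : ℕ := ∏ k ∈ s with 0 < k, k.toNat
  have hD : 0 < D := Finset.prod_pos fun k hk => by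
    have := (Finset.mem_filter.1 hk).2
    omega
  have hsD : ∀ k ∈ s, 0 < k → k ∣ (D : ℤ) := fun k hks hk => by
    rw [← Int.toNat_of_nonneg hk.le]
    exact_mod_cast Finset.dvd_prod_of_mem Int.toNat (Finset.mem_filter.2 ⟨hks, hk⟩)
  have hq : (q : ℚ) = (q * D : ℕ) / (D : ℤ) := by
    push_cast
    field_simp
  rw [hq] at h
  exact h.exists_hasSlopeLE_zero_of_div hCFT hs (by exact_mod_cast hD) hsD hw

end WeakModule

end VertexOperatorAlgebra

theorem lemma4p4 {V : Type*} [AddCommGroup V] [Module ℂ V]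
    (A : VertexOperatorAlgebra V) (hCFT : A.IsCFTType) (hC2 : A.IsCofinite 2)
    {M : Type*} [AddCommGroup M] [Module ℂ M] [Nontrivial M] (W : A.WeakModule M) :
    ∃ w : M, w ≠ 0 ∧ W.IsLowestWeightVector w := by
  obtain ⟨s, hs⟩ := hC2.exists_gr_le_CPart
  obtain ⟨w, hw⟩ := exists_ne (0 : M)
  obtain ⟨q, hq⟩ := VertexOperatorAlgebra.WeakModule.exists_hasSlopeLE_natCast (W := W) hCFT hs w
  obtain ⟨w', hw', hslope⟩ := hq.exists_hasSlopeLE_zero hCFT hs hw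
  exact ⟨w', hw', VertexOperatorAlgebra.WeakModule.hasSlopeLE_zero_iff.1 hslope⟩
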